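/- For a finite group $H$ let $d(H)$ denote the minimal number of generators of $H$, and let the (Prüfer) rank of a finite group $G$ be $\max\{d(H) : H \le G\}$. Let $p$ be a prime and let $G$ be a finite $p$-group of rank $k$. Then every $p$-subgroup $P$ of $\mathrm{Aut}(G)$ can be generated by at most $\frac{9k^2}{4}$ elements if $p>2$, and by at most $\frac{7k^2-k}{2}$ elements if $p=2$. -/

import Mathlib

/-- The (Prüfer) rank of a group `G`: the supremum, in `ℕ∞`, of the minimal numbers of generators
`d(H) = Group.rank H` of the finitely generated subgroups `H` of `G`. -/
noncomputable def pruferRank (G : Type*) [Group G] : ℕ∞ :=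
  ⨆ (H : Subgroup G) (_ : Group.FG H), (Group.rank H : ℕ∞)

/-! Let Q = Inn(G)P, again a p-group, and let A be maximal among the Q-invariant abelian subgroups
of G. Were A smaller than its centralizer C, Q would fix a nontrivial coset xA in C, and ⟨x, A⟩
would be a larger such subgroup; so A is its own centralizer. Restrict P to A. The kernel acts
trivially on A, hence also on the cosets of A, and the maps φ ↦ g⁻¹φ(g), for g in a generating set
of G, embed it in a power A^k. This costs k² generators (`generatedBy_of_fixes`).

The image of P acts faithfully on A, and on A/pA, of dimension r ≤ k, by unitriangular matrices. A
unitriangular group over a prime field needs one generator for each leading position that is not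
composed of two others. Commutators make the leading positions a transitive relation, so the
indecomposable ones form a triangle-free graph, and Mantel's theorem gives r²/4
(`generatedBy_of_unitriangular`).

Elements trivial on A/pA act as 1 + p^i Y, with Y an integer matrix over a generating family of A.
The p-th power map keeps Y mod p and raises i by one, so the leading coefficients form an increasing
chain of subspaces of a space of dimension r², and r² generators suffice
(`generatedBy_of_le_levelSubgroup`). For p = 2 this fails at i = 1, and that level costs r² more. As
A need not be free, Y is not determined by the automorphism; hence levels are defined through a
submonoid `ρ` of `X × R` instead of a homomorphism.

The sum is k²/4 + k² + k² for odd p and k²/4 + 2k² + k² for p = 2. -/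

/-- `H` can be generated by at most `m` elements. -/
def Subgroup.GeneratedBy {X : Type*} [Group X] (H : Subgroup X) (m : ℕ) : Prop :=
  ∃ S : Finset X, S.card ≤ m ∧ Subgroup.closure (S : Set X) = H

/-! ### Counting generators through extensions. -/

namespace Subgroup.GeneratedBy

variable {X Y : Type*} [Group X] [Group Y]

theorem mono {H : Subgroup X} {m n : ℕ} (h : H.GeneratedBy m) (hmn : m ≤ n) :
    H.GeneratedBy n := by
  obtain ⟨S, hS, hc⟩ := h
  exact ⟨S, hS.trans hmn, hc⟩

theorem map {H : Subgroup X} {m : ℕ} (h : H.GeneratedBy m) (f : X →* Y) :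
    (H.map f).GeneratedBy m := by
  classical
  obtain ⟨S, hS, hc⟩ := h
  refine ⟨S.image f, Finset.card_image_le.trans hS, ?_⟩
  rw [Finset.coe_image, ← MonoidHom.map_closure, hc]

theorem of_forall_mul_mem {H N : Subgroup X} {m : ℕ} (hN : N.GeneratedBy m) (hNH : N ≤ H)
    (S : Finset X) (hSH : (S : Set X) ⊆ H)
    (h : ∀ x ∈ H, ∃ s ∈ closure (S : Set X), x * s ∈ N) :
    H.GeneratedBy (S.card + m) := by
  classical
  obtain ⟨T, hT, hc⟩ := hN
  refine ⟨S ∪ T, (Finset.card_union_le _ _).trans (by omega), ?_⟩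
  rw [Finset.coe_union, closure_union, hc]
  refine le_antisymm (sup_le ((closure_le H).2 hSH) hNH) fun x hx => ?_
  obtain ⟨s, hs, hxs⟩ := h x hx
  rw [← mul_inv_cancel_right x s]
  exact mul_mem (mem_sup_right hxs) (mem_sup_left (inv_mem hs))

theorem of_range_of_ker {H : Subgroup X} (f : H →* Y) {m n : ℕ} (h₁ : f.range.GeneratedBy m)
    (h₂ : (f.ker.map H.subtype).GeneratedBy n) : H.GeneratedBy (m + n) := by
  classical
  obtain ⟨S, hS, hc⟩ := h₁
  have hl : ∀ y : Y, ∃ x : H, y ∈ f.range → f x = y := fun y => by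
    by_cases hy : y ∈ f.range
    · obtain ⟨x, hx⟩ := hy
      exact ⟨x, fun _ => hx⟩
    · exact ⟨1, fun h => absurd h hy⟩
  choose l hl using hl
  have hSl : f '' (l '' (S : Set Y)) = S := by
    rw [← Set.image_comp]
    refine (Set.image_congr fun y hy => ?_).trans (Set.image_id _)
    exact hl y (hc ▸ subset_closure hy)
  refine (of_forall_mul_mem h₂ (map_subtype_le _) (S.image fun y => (l y : X)) ?_ ?_).mono
    (Nat.add_le_add_right (Finset.card_image_le.trans hS) n)
  · intro x hx
    obtain ⟨y, -, rfl⟩ := Finset.mem_image.1 (Finset.mem_coe.1 hx)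
    exact (l y).2
  · intro x hx
    have : (f ⟨x, hx⟩)⁻¹ ∈ (closure (l '' (S : Set Y))).map f := by
      rw [MonoidHom.map_closure, hSl, hc]
      exact inv_mem ⟨_, rfl⟩
    obtain ⟨s, hs, hfs⟩ := this
    refine ⟨s, ?_, ⟨⟨x, hx⟩ * s, ?_, rfl⟩⟩
    · have h3 := mem_map_of_mem H.subtype hs
      rw [MonoidHom.map_closure, ← Set.image_comp] at h3
      rw [Finset.coe_image]
      exact h3
    · simp only [SetLike.mem_coe, MonoidHom.mem_ker, map_mul, hfs, mul_inv_cancel]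

end Subgroup.GeneratedBy

/-! ### Automorphisms trivial on a subgroup and on its cosets. -/

/-- A group of automorphisms of `G` acting trivially on a subgroup `A` and on the cosets of `A`
embeds in a power of `A`, with one factor for every element of a separating set. -/
theorem generatedBy_of_fixes {G : Type*} [Group G] (A : Subgroup G) (k : ℕ)
    (hA : ∀ B ≤ A, B.GeneratedBy k) (T : Finset G) (N : Subgroup (MulAut G))
    (h₁ : ∀ φ ∈ N, ∀ a ∈ A, φ a = a) (h₂ : ∀ φ ∈ N, ∀ g, g⁻¹ * φ g ∈ A)
    (h₃ : ∀ φ ∈ N, (∀ t ∈ T, φ t = t) → φ = 1) : N.GeneratedBy (T.card * k) := by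
  classical
  induction T using Finset.induction_on generalizing N with
  | empty =>
    refine ⟨∅, by simp, ?_⟩
    rw [Finset.coe_empty, Subgroup.closure_empty, eq_comm, Subgroup.eq_bot_iff_forall]
    exact fun φ hφ => h₃ φ hφ (by simp)
  | insert g T hg ih =>
    -- Multiplicative because φ fixes g⁻¹ψ(g) ∈ A: φψ(g) = φ(g · g⁻¹ψ(g)) = φ(g) · g⁻¹ψ(g). Its
    -- kernel fixes g, so the induction continues there with one test element fewer.
    let f : N →* G :=
      { toFun := fun φ => g⁻¹ * (φ : MulAut G) g
        map_one' := by simp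
        map_mul' := fun φ ψ => by
          have h := h₁ _ φ.2 _ (h₂ _ ψ.2 g)
          rw [map_mul, map_inv] at h
          have h' : (φ : MulAut G) ((ψ : MulAut G) g) =
              (φ : MulAut G) g * (g⁻¹ * (ψ : MulAut G) g) := by
            rw [← h]; group
          simp only [Subgroup.coe_mul, MulAut.mul_apply]
          rw [h', mul_assoc] }
    have hf : f.range ≤ A := by
      rintro _ ⟨φ, rfl⟩
      exact h₂ _ φ.2 g
    have hle : f.ker.map N.subtype ≤ N := Subgroup.map_subtype_le _
    rw [Finset.card_insert_of_notMem hg, add_comm, add_mul, one_mul]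
    refine Subgroup.GeneratedBy.of_range_of_ker f (hA _ hf)
      (ih _ (fun φ hφ => h₁ φ (hle hφ)) (fun φ hφ => h₂ φ (hle hφ)) ?_)
    rintro _ ⟨φ, hφ, rfl⟩ h
    refine h₃ _ φ.2 fun t ht => ?_
    rcases Finset.mem_insert.1 ht with rfl | ht
    · exact (inv_mul_eq_one.1 (MonoidHom.mem_ker.1 hφ)).symm
    · exact h t ht

/-! ### Powers of elements congruent to 1. -/

theorem exists_one_add_pow_eq {R : Type*} [Ring R] (z : R) (n : ℕ) :
    ∃ r : R, (1 + z) ^ n = 1 + n * z + (n.choose 2 : ℕ) * z ^ 2 + z ^ 3 * r := by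
  induction n with
  | zero => exact ⟨0, by simp⟩
  | succ n ih =>
    obtain ⟨r, h⟩ := ih
    refine ⟨r + r * z + (n.choose 2 : ℕ), ?_⟩
    have e1 : (n : R) * z * z = n * z ^ 2 := by rw [mul_assoc, sq]
    have e2 : ((n.choose 2 : ℕ) : R) * z ^ 2 * z = z ^ 3 * (n.choose 2 : ℕ) := by
      rw [mul_assoc, ← pow_succ]; exact (Nat.cast_commute _ _).eq
    rw [pow_succ, h, Nat.choose_succ_succ' n 1, Nat.choose_one_right]
    push_cast
    simp only [mul_add, add_mul, mul_one, one_mul, e1, e2]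
    rw [mul_assoc (z ^ 3) r z]
    abel

/-- The leading coefficient of `1 + p ^ i * y` is preserved by the `p`-th power map, which raises
the level by one. -/
theorem exists_one_add_natCast_pow_mul_pow {R : Type*} [Ring R] {p : ℕ} (hp : p.Prime) {i : ℕ}
    (hi : 1 ≤ i) (hpi : p = 2 → 2 ≤ i) (y : R) :
    ∃ z : R, (1 + (p : R) ^ i * y) ^ p = 1 + (p : R) ^ (i + 1) * (y + p * z) := by
  obtain ⟨r, h⟩ := exists_one_add_pow_eq ((p : R) ^ i * y) p
  have hc : ∀ m n : ℕ, Commute ((p : R) ^ m) (y ^ n) := fun m n =>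
    ((Nat.cast_commute p y).pow_pow m n)
  have hpow : ∀ n : ℕ, ((p : R) ^ i * y) ^ n = (p : R) ^ (i * n) * y ^ n := fun n => by
    rw [(by simpa using hc i 1 : Commute ((p : R) ^ i) y).mul_pow, ← pow_mul]
  have h1 : (p : R) * ((p : R) ^ i * y) = (p : R) ^ (i + 1) * y := by
    rw [← mul_assoc, pow_succ']
  rcases hp.eq_two_or_odd with rfl | hodd
  -- The square contributes 2^(2i) y², divisible by 2^(i+2) only if i ≥ 2; at i = 1 the leading
  -- coefficient becomes y + y².
  · obtain ⟨j, rfl⟩ := Nat.exists_eq_add_of_le (hpi rfl)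
    refine ⟨(2 : ℕ) ^ j * y ^ 2, ?_⟩
    rw [sq, add_mul, one_mul, mul_add, mul_one, ← sq, hpow, mul_add]
    have : ((2 : ℕ) : R) ^ ((2 + j) * 2) * y ^ 2 =
        ((2 : ℕ) : R) ^ (2 + j + 1) * (((2 : ℕ) : R) * (((2 : ℕ) : R) ^ j * y ^ 2)) := by
      rw [← mul_assoc, ← mul_assoc, ← pow_succ, ← pow_add]
      congr 2; ring
    rw [this, ← h1]
    push_cast
    rw [two_mul ((2 : R) ^ (2 + j) * y)]
    abel
  -- At i = 1 the quadratic term needs the extra factor p of `p.choose 2`; the cubic term has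
  -- p^(3i), already divisible by p^(i+2).
  · obtain ⟨j, rfl⟩ := Nat.exists_eq_add_of_le hi
    obtain ⟨c, hc2⟩ : p ∣ p.choose 2 :=
      hp.dvd_choose_self (by norm_num) (lt_of_le_of_ne hp.two_le (by rintro rfl; omega))
    refine ⟨(p : R) ^ j * c * y ^ 2 + (p : R) ^ (2 * j) * (y ^ 3 * r), ?_⟩
    rw [h, h1, hpow, hpow, hc2, mul_add, mul_add, mul_add]
    have e1 : ((p * c : ℕ) : R) * ((p : R) ^ ((1 + j) * 2) * y ^ 2) =
        (p : R) ^ (1 + j + 1) * ((p : R) * ((p : R) ^ j * c * y ^ 2)) := by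
      simp only [← mul_assoc, ← pow_succ, ← pow_add]
      congr 1
      push_cast
      rw [(Nat.cast_commute p (c : R)).eq, mul_assoc, ← pow_succ',
        ((Nat.cast_commute c (p : R)).pow_right _).eq]
      congr 2; ring
    have e2 : (p : R) ^ ((1 + j) * 3) * y ^ 3 * r =
        (p : R) ^ (1 + j + 1) * ((p : R) * ((p : R) ^ (2 * j) * (y ^ 3 * r))) := by
      simp only [← mul_assoc, ← pow_succ, ← pow_add]
      congr 3; ring
    rw [e1, e2]
    abel

theorem Submodule.exists_finset_sup_span {K V : Type*} [Field K] [AddCommGroup V] [Module K V]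
    [FiniteDimensional K V] {W W' : Submodule K V} (h : W ≤ W') :
    ∃ T : Finset V, (T : Set V) ⊆ W' ∧ W ⊔ span K (T : Set V) = W' ∧
      Module.finrank K W + T.card ≤ Module.finrank K W' := by
  classical
  obtain ⟨C, hC⟩ := exists_isCompl W
  have hsup : W ⊔ C ⊓ W' = W' := by
    rw [← sup_inf_assoc_of_le C h, hC.sup_eq_top, top_inf_eq]
  have hinf : W ⊓ (C ⊓ W') = ⊥ := by rw [← inf_assoc, hC.inf_eq_bot, bot_inf_eq]
  have hdim := finrank_sup_add_finrank_inf_eq W (C ⊓ W')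
  rw [hsup, hinf, finrank_bot, add_zero] at hdim
  have hspan : span K ((Finset.univ.image fun i =>
      (Module.finBasis K ↥(C ⊓ W') i : V) : Finset V) : Set V) = C ⊓ W' := by
    rw [Finset.coe_image, Finset.coe_univ, Set.image_univ]
    have := congrArg (map (C ⊓ W').subtype) (Module.finBasis K ↥(C ⊓ W')).span_eq
    rw [map_span, ← Set.range_comp, map_top, range_subtype] at this
    exact this
  refine ⟨Finset.univ.image fun i => (Module.finBasis K ↥(C ⊓ W') i : V), ?_, ?_, ?_⟩
  · exact (span_le.1 hspan.le).trans fun x hx => hx.2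
  · rw [hspan, hsup]
  · rw [hdim]
    exact Nat.add_le_add_left (Finset.card_image_le.trans (by simp)) _

/-! ### Congruence levels and leading coefficients. -/

section Levels

variable {X R V : Type*} [Group X] [Ring R] {p : ℕ} [AddCommGroup V] [Module (ZMod p) V]

/-- The elements related to an element of `R` congruent to `1` modulo `p ^ i`. -/
def levelSubgroup [Finite X] (ρ : Submonoid (X × R)) (p i : ℕ) : Subgroup X where
  carrier := {x | ∃ y : R, (x, 1 + (p : R) ^ i * y) ∈ ρ}
  one_mem' := ⟨0, by rw [mul_zero, add_zero]; exact ρ.one_mem⟩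
  mul_mem' := by
    rintro x x' ⟨y, hy⟩ ⟨y', hy'⟩
    refine ⟨y + y' + y * ((p : R) ^ i * y'), ?_⟩
    have := ρ.mul_mem hy hy'
    rw [Prod.mk_mul_mk] at this
    convert this using 2
    noncomm_ring
  inv_mem' := by
    rintro x ⟨y, hy⟩
    -- The partner 1 + p^i y need not be invertible in R, so the inverse of x is reached as a
    -- positive or zero power of x.
    have key : ∀ n : ℕ, ∃ y : R, (x ^ n, 1 + (p : R) ^ i * y) ∈ ρ := fun n => by
      induction n with
      | zero => exact ⟨0, by rw [pow_zero]; rw [mul_zero, add_zero]; exact ρ.one_mem⟩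
      | succ n ih =>
        obtain ⟨z, hz⟩ := ih
        refine ⟨z + y + z * ((p : R) ^ i * y), ?_⟩
        have := ρ.mul_mem hz hy
        rw [Prod.mk_mul_mk, ← pow_succ] at this
        convert this using 2
        noncomm_ring
    have := key (orderOf x - 1)
    rwa [show x ^ (orderOf x - 1) = x⁻¹ from
      eq_inv_of_mul_eq_one_left (by
        rw [← pow_succ, Nat.sub_add_cancel (orderOf_pos x), pow_orderOf_eq_one])] at this

theorem map_natCast_mul_eq_zero (q : R →+ V) (z : R) : q ((p : R) * z) = 0 := by
  rw [← nsmul_eq_mul, map_nsmul, ← Nat.cast_smul_eq_nsmul (ZMod p), ZMod.natCast_self, zero_smul]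

/-- The cross term p^i y p^i y' contributes p^i y y' to the new coefficient, which `q` kills since i
≥ 1. -/
theorem exists_map_eq_add_of_mem (ρ : Submonoid (X × R)) (q : R →+ V) {i : ℕ} (hi : 1 ≤ i)
    {x x' : X} {y y' : R} (hx : (x, 1 + (p : R) ^ i * y) ∈ ρ)
    (hx' : (x', 1 + (p : R) ^ i * y') ∈ ρ) :
    ∃ z : R, (x * x', 1 + (p : R) ^ i * z) ∈ ρ ∧ q z = q y + q y' := by
  obtain ⟨j, rfl⟩ := Nat.exists_eq_add_of_le hi
  have hc : y * ((p : R) ^ (1 + j) * y') = p * ((p : R) ^ j * (y * y')) := by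
    rw [← mul_assoc, ← ((Nat.cast_commute p y).pow_left (1 + j)).eq, pow_add, pow_one]
    simp only [mul_assoc]
  refine ⟨y + y' + p * ((p : R) ^ j * (y * y')), ?_, ?_⟩
  · have := ρ.mul_mem hx hx'
    rw [Prod.mk_mul_mk] at this
    rw [← hc]
    convert this using 2
    noncomm_ring
  · rw [map_add, map_add, map_natCast_mul_eq_zero, add_zero]

/-- The leading coefficients, taken modulo `p`, of the elements of `H` of level `i`. -/
def leadingSubmodule [NeZero p] (ρ : Submonoid (X × R)) (q : R →+ V) (H : Subgroup X) {i : ℕ}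
    (hi : 1 ≤ i) :
    Submodule (ZMod p) V :=
  have hadd : ∀ {v w : V}, (∃ x ∈ H, ∃ y : R, (x, 1 + (p : R) ^ i * y) ∈ ρ ∧ q y = v) →
      (∃ x ∈ H, ∃ y : R, (x, 1 + (p : R) ^ i * y) ∈ ρ ∧ q y = w) →
      ∃ x ∈ H, ∃ y : R, (x, 1 + (p : R) ^ i * y) ∈ ρ ∧ q y = v + w := by
    rintro _ _ ⟨x, hx, y, hy, rfl⟩ ⟨x', hx', y', hy', rfl⟩
    obtain ⟨z, hz, hqz⟩ := exists_map_eq_add_of_mem ρ q hi hy hy'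
    exact ⟨_, mul_mem hx hx', z, hz, hqz⟩
  let M : AddSubmonoid V :=
    { carrier := {v | ∃ x ∈ H, ∃ y : R, (x, 1 + (p : R) ^ i * y) ∈ ρ ∧ q y = v}
      zero_mem' := ⟨1, H.one_mem, 0, by rw [mul_zero, add_zero]; exact ρ.one_mem, map_zero q⟩
      add_mem' := hadd }
  { M with
    smul_mem' := fun c v hv => by
      obtain ⟨n, rfl⟩ := ZMod.natCast_zmod_surjective c
      rw [Nat.cast_smul_eq_nsmul]
      exact M.nsmul_mem hv n }

theorem leadingSubmodule_mono [NeZero p] (ρ : Submonoid (X × R)) (q : R →+ V) {H K : Subgroup X}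
    (h : H ≤ K) {i : ℕ} (hi : 1 ≤ i) : leadingSubmodule (p := p) ρ q H hi ≤ leadingSubmodule ρ q K hi := by
  rintro _ ⟨x, hx, y, hy⟩
  exact ⟨x, h hx, y, hy⟩

/-- Take p-th powers inside H. This monotonicity is what bounds all levels together by a single
dimension. -/
theorem leadingSubmodule_le_succ [Fact p.Prime] (ρ : Submonoid (X × R)) (q : R →+ V)
    (H : Subgroup X) {i : ℕ} (hi : 1 ≤ i) (hpi : p = 2 → 2 ≤ i) :
    leadingSubmodule (p := p) ρ q H hi ≤ leadingSubmodule ρ q H (hi.trans i.le_succ) := by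
  rintro _ ⟨x, hx, y, hy, rfl⟩
  obtain ⟨z, hz⟩ := exists_one_add_natCast_pow_mul_pow Fact.out hi hpi y
  refine ⟨x ^ p, pow_mem hx p, y + p * z, ?_, ?_⟩
  · rw [Nat.succ_eq_add_one, ← hz]
    exact ρ.pow_mem hy p
  · rw [map_add, map_natCast_mul_eq_zero, add_zero]

/-- Multiplication by a suitable element cancels the leading coefficient. -/
theorem exists_mul_mem_levelSubgroup [Finite X] [NeZero p] {ρ : Submonoid (X × R)} {q : R →+ V}
    (hq : ∀ y, q y = 0 → ∃ z, y = p * z) {K : Subgroup X} {i : ℕ} (hi : 1 ≤ i) {x : X} {y : R}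
    (hx : (x, 1 + (p : R) ^ i * y) ∈ ρ) (hy : q y ∈ leadingSubmodule (p := p) ρ q K hi) :
    ∃ s ∈ K, x * s ∈ levelSubgroup ρ p (i + 1) := by
  obtain ⟨s, hs, y', hy', hqy⟩ := (Submodule.neg_mem_iff _).2 hy
  obtain ⟨z, hz, hqz⟩ := exists_map_eq_add_of_mem ρ q hi hx hy'
  rw [hqy, add_neg_cancel] at hqz
  obtain ⟨w, rfl⟩ := hq z hqz
  exact ⟨s, hs, w, by rwa [pow_succ, mul_assoc]⟩

/-- A finite set of elements of `H` of level `i` spanning, with `W`, the leading coefficients. -/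
theorem exists_finset_sup_leadingSubmodule [Fact p.Prime] [FiniteDimensional (ZMod p) V]
    (ρ : Submonoid (X × R)) (q : R →+ V) (H : Subgroup X) {i : ℕ} (hi : 1 ≤ i)
    {W : Submodule (ZMod p) V} (hW : W ≤ leadingSubmodule ρ q H hi) :
    ∃ S : Finset X, (S : Set X) ⊆ H ∧
      Module.finrank (ZMod p) W + S.card ≤
        Module.finrank (ZMod p) (leadingSubmodule (p := p) ρ q H hi) ∧
      ∀ K : Subgroup X, (S : Set X) ⊆ K → W ≤ leadingSubmodule ρ q K hi →
        leadingSubmodule (p := p) ρ q H hi ≤ leadingSubmodule ρ q K hi := by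
  classical
  obtain ⟨T, hT, hsup, hcard⟩ := Submodule.exists_finset_sup_span hW
  have hl : ∀ v : V, ∃ x : X, v ∈ T → x ∈ H ∧ ∃ y : R, (x, 1 + (p : R) ^ i * y) ∈ ρ ∧ q y = v :=
    fun v => by
      by_cases hv : v ∈ T
      · obtain ⟨x, hx⟩ := hT hv
        exact ⟨x, fun _ => hx⟩
      · exact ⟨1, fun h => absurd h hv⟩
  choose l hl using hl
  refine ⟨T.image l, ?_, (Nat.add_le_add_left Finset.card_image_le _).trans hcard,
    fun K hK hWK => ?_⟩
  · intro x hx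
    obtain ⟨v, hv, rfl⟩ := Finset.mem_image.1 (Finset.mem_coe.1 hx)
    exact (hl v hv).1
  · rw [← hsup]
    refine sup_le hWK (Submodule.span_le.2 fun v hv => ?_)
    exact ⟨l v, hK (Finset.mem_coe.2 (Finset.mem_image_of_mem l hv)), (hl v hv).2⟩

/-- Going up the levels, new generators are needed only for a complement of the previous leading
space, since p-th powers of the old ones supply the rest. The count telescopes to at most dim V. An
element of H is then corrected level by level until it reaches level n, which is trivial. -/
theorem generatedBy_of_le_levelSubgroup [Finite X] [Fact p.Prime] [FiniteDimensional (ZMod p) V]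
    {ρ : Submonoid (X × R)} {q : R →+ V} (hq : ∀ y, q y = 0 → ∃ z, y = p * z) {n : ℕ}
    (hn : levelSubgroup ρ p n = ⊥) {i : ℕ} (hi : 1 ≤ i) (hpi : p = 2 → 2 ≤ i) (hin : i ≤ n)
    {H : Subgroup X} (hH : H ≤ levelSubgroup ρ p i) :
    H.GeneratedBy (Module.finrank (ZMod p) V) := by
  classical
  have key : ∀ d : ℕ, ∃ S : Finset X, (S : Set X) ⊆ H ∧
      S.card ≤ Module.finrank (ZMod p)
        (leadingSubmodule (p := p) ρ q H (hi.trans (Nat.le_add_right i d))) ∧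
      ∀ j ≤ d, leadingSubmodule (p := p) ρ q H (hi.trans (Nat.le_add_right i j)) ≤
        leadingSubmodule ρ q (Subgroup.closure (S : Set X)) (hi.trans (Nat.le_add_right i j)) := by
    intro d
    induction d with
    | zero =>
      obtain ⟨S, hS, hcard, h⟩ := exists_finset_sup_leadingSubmodule ρ q H
        (hi.trans (Nat.le_add_right i 0)) (bot_le : (⊥ : Submodule (ZMod p) V) ≤ _)
      refine ⟨S, hS, by omega, fun j hj => ?_⟩
      obtain rfl := Nat.le_zero.1 hj
      exact h _ Subgroup.subset_closure bot_le
    | succ d ih =>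
      obtain ⟨S, hS, hcard, h⟩ := ih
      obtain ⟨T, hT, hcard', h'⟩ := exists_finset_sup_leadingSubmodule ρ q H
        (hi.trans (Nat.le_add_right i (d + 1)))
        (leadingSubmodule_le_succ (p := p) ρ q H (hi.trans (Nat.le_add_right i d))
          fun h2 => (hpi h2).trans (Nat.le_add_right i d))
      have hST : Subgroup.closure (S : Set X) ≤ Subgroup.closure ((S ∪ T : Finset X) : Set X) :=
        Subgroup.closure_mono (by simp)
      refine ⟨S ∪ T, ?_, (Finset.card_union_le _ _).trans (by omega), fun j hj => ?_⟩
      · rw [Finset.coe_union]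
        exact Set.union_subset hS hT
      · rcases Nat.le_succ_iff.1 hj with hj | rfl
        · exact (h j hj).trans (leadingSubmodule_mono ρ q hST _)
        · refine h' _ (Set.Subset.trans (by simp) Subgroup.subset_closure) ?_
          exact ((h d le_rfl).trans (leadingSubmodule_mono ρ q hST _)).trans
            (leadingSubmodule_le_succ ρ q _ _ fun h2 => (hpi h2).trans (Nat.le_add_right i d))
  obtain ⟨S, hS, hcard, h⟩ := key (n - i)
  refine ⟨S, hcard.trans (Submodule.finrank_le _), le_antisymm ((Subgroup.closure_le H).2 hS) ?_⟩
  have desc : ∀ d j : ℕ, j + d = n - i → ∀ x ∈ H, x ∈ levelSubgroup ρ p (i + j) →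
      x ∈ Subgroup.closure (S : Set X) := by
    intro d
    induction d with
    | zero =>
      intro j hj x _ hx
      rw [show i + j = n by omega, hn, Subgroup.mem_bot] at hx
      rw [hx]
      exact one_mem _
    | succ d ih =>
      rintro j hj x hxH ⟨y, hy⟩
      obtain ⟨s, hs, hxs⟩ := exists_mul_mem_levelSubgroup hq (hi.trans (Nat.le_add_right i j)) hy
        (h j (by omega) ⟨x, hxH, y, hy, rfl⟩)
      have := ih (j + 1) (by omega) (x * s)
        (mul_mem hxH ((Subgroup.closure_le H).2 hS hs)) hxs
      rw [← mul_inv_cancel_right x s]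
      exact mul_mem this (inv_mem hs)
  exact fun x hx => desc (n - i) 0 (by omega) x hx (hH hx)

/-- Treats one level by itself, without the power map; it serves level 1 when p = 2. -/
theorem generatedBy_add_of_le_levelSubgroup [Finite X] [Fact p.Prime]
    [FiniteDimensional (ZMod p) V] {ρ : Submonoid (X × R)} {q : R →+ V}
    (hq : ∀ y, q y = 0 → ∃ z, y = p * z) {i : ℕ} (hi : 1 ≤ i) {H : Subgroup X}
    (hH : H ≤ levelSubgroup ρ p i) {m : ℕ} (hm : (H ⊓ levelSubgroup ρ p (i + 1)).GeneratedBy m) :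
    H.GeneratedBy (Module.finrank (ZMod p) V + m) := by
  obtain ⟨S, hS, hcard, h⟩ := exists_finset_sup_leadingSubmodule ρ q H hi
    (bot_le : (⊥ : Submodule (ZMod p) V) ≤ _)
  refine (hm.of_forall_mul_mem inf_le_left S hS fun x hx => ?_).mono
    (Nat.add_le_add_right ((Nat.le_add_left _ _).trans (hcard.trans (Submodule.finrank_le _))) m)
  obtain ⟨y, hy⟩ := hH hx
  obtain ⟨s, hs, hxs⟩ := exists_mul_mem_levelSubgroup hq hi hy
    (h _ Subgroup.subset_closure bot_le ⟨x, hx, y, hy, rfl⟩)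
  exact ⟨s, hs, mul_mem hx ((Subgroup.closure_le H).2 hS hs), hxs⟩

end Levels

/-! ### Unitriangular groups over a prime field. -/

section Unitriangular

variable {F : Type*} [Field F] {r : ℕ}

/-- The matrices whose nonzero entries `(i, j)` satisfy `2 ^ j - 2 ^ i ≥ c`. Distinct positions
above the diagonal have distinct weights `2 ^ j - 2 ^ i`. -/
def weightSubgroup (F : Type*) [Field F] (r c : ℕ) : AddSubgroup (Matrix (Fin r) (Fin r) F) where
  carrier := {x | ∀ i j, x i j ≠ 0 → 2 ^ (i : ℕ) + c ≤ 2 ^ (j : ℕ)}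
  zero_mem' := fun i j h => absurd rfl h
  add_mem' := fun {x y} hx hy i j h => by
    by_cases hxi : x i j = 0
    · exact hy i j (by simpa [hxi] using h)
    · exact hx i j hxi
  neg_mem' := fun {x} hx i j h => hx i j (by simpa using h)

theorem mem_weightSubgroup {c : ℕ} {x : Matrix (Fin r) (Fin r) F} :
    x ∈ weightSubgroup F r c ↔ ∀ i j, x i j ≠ 0 → 2 ^ (i : ℕ) + c ≤ 2 ^ (j : ℕ) :=
  Iff.rfl

theorem weightSubgroup_anti {c d : ℕ} (h : c ≤ d) : weightSubgroup F r d ≤ weightSubgroup F r c :=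
  fun _ hx i j hij => (Nat.add_le_add_left h _).trans (hx i j hij)

/-- Weights telescope: (2^l - 2^i) + (2^j - 2^l) = 2^j - 2^i. -/
theorem mul_mem_weightSubgroup {c d : ℕ} {x y : Matrix (Fin r) (Fin r) F}
    (hx : x ∈ weightSubgroup F r c) (hy : y ∈ weightSubgroup F r d) :
    x * y ∈ weightSubgroup F r (c + d) := by
  intro i j h
  rw [Matrix.mul_apply] at h
  obtain ⟨l, -, hl⟩ := Finset.exists_ne_zero_of_sum_ne_zero h
  have h1 := hx i l (left_ne_zero_of_mul hl)
  have h2 := hy l j (right_ne_zero_of_mul hl)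
  omega

theorem eq_zero_of_mem_weightSubgroup {x : Matrix (Fin r) (Fin r) F}
    (hx : x ∈ weightSubgroup F r (2 ^ r)) : x = 0 := by
  ext i j
  by_contra h
  have := hx i j h
  have h2 : 2 ^ (j : ℕ) < 2 ^ r := Nat.pow_lt_pow_right (by norm_num) j.2
  have h3 : 0 < 2 ^ (i : ℕ) := by positivity
  omega

/-- The positions of the leading entries of the elements of `H`. -/
def leadingPositions (H : Subgroup (Matrix (Fin r) (Fin r) F)ˣ) : Set (Fin r × Fin r) :=
  {a | a.1 < a.2 ∧ ∃ g ∈ H, (g : Matrix (Fin r) (Fin r) F) - 1 ∈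
    weightSubgroup F r (2 ^ (a.2 : ℕ) - 2 ^ (a.1 : ℕ)) ∧ (g : Matrix (Fin r) (Fin r) F) a.1 a.2 ≠ 0}

/-- If b < d, then 2^b and 2^c are both at most 2^(d-1), so the left side is at most 2^d, less than
the right; symmetrically for d < b. The sums avoid truncated subtraction. -/
theorem two_pow_sub_two_pow_inj {a b c d : ℕ} (hab : a < b) (hcd : c < d)
    (h : 2 ^ b + 2 ^ c = 2 ^ d + 2 ^ a) : a = c ∧ b = d := by
  have h1 : ∀ {m n : ℕ}, m < n → 2 * 2 ^ m ≤ 2 ^ n := fun {m n} hmn => by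
    rw [← pow_succ']; exact Nat.pow_le_pow_right (by norm_num) hmn
  have hbd : b = d := by
    rcases lt_trichotomy b d with hlt | heq | hlt
    · have := h1 hlt; have := h1 hcd; have := h1 hab
      have : 0 < 2 ^ a := by positivity
      omega
    · exact heq
    · have := h1 hlt; have := h1 hcd; have := h1 hab
      have : 0 < 2 ^ c := by positivity
      omega
  subst hbd
  exact ⟨(Nat.pow_right_injective le_rfl (by dsimp only; omega)), rfl⟩

theorem sub_one_mul_mem_weightSubgroup {c : ℕ} {x u : Matrix (Fin r) (Fin r) F}
    (hx : x ∈ weightSubgroup F r c) (hu : u - 1 ∈ weightSubgroup F r 1) :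
    x * u - x ∈ weightSubgroup F r (c + 1) := by
  rw [← mul_sub_one]
  exact mul_mem_weightSubgroup hx hu

/-- The set of leading positions is transitive, by taking commutators. -/
theorem leadingPositions_trans {H : Subgroup (Matrix (Fin r) (Fin r) F)ˣ}
    (hH : ∀ g ∈ H, (g : Matrix (Fin r) (Fin r) F) - 1 ∈ weightSubgroup F r 1) {a b c : Fin r}
    (hab : (a, b) ∈ leadingPositions H) (hbc : (b, c) ∈ leadingPositions H) :
    (a, c) ∈ leadingPositions H := by
  obtain ⟨hab', g, hg, hgw, hg0⟩ := hab
  obtain ⟨hbc', h, hh, hhw, hh0⟩ := hbc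
  simp only at hab' hgw hg0 hbc' hhw hh0
  have hac : a < c := hab'.trans hbc'
  set x : Matrix (Fin r) (Fin r) F := g - 1 with hx
  set y : Matrix (Fin r) (Fin r) F := h - 1 with hy
  have pab : 2 ^ (a : ℕ) < 2 ^ (b : ℕ) := Nat.pow_lt_pow_right (by norm_num) hab'
  have pbc : 2 ^ (b : ℕ) < 2 ^ (c : ℕ) := Nat.pow_lt_pow_right (by norm_num) hbc'
  have hwsum : (2 ^ (b : ℕ) - 2 ^ (a : ℕ)) + (2 ^ (c : ℕ) - 2 ^ (b : ℕ)) =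
      2 ^ (c : ℕ) - 2 ^ (a : ℕ) := by omega
  have hxy := mul_mem_weightSubgroup hgw hhw
  have hyx := mul_mem_weightSubgroup hhw hgw
  rw [add_comm, hwsum] at hyx
  rw [hwsum] at hxy
  have hu : ((h * g)⁻¹ : (Matrix (Fin r) (Fin r) F)ˣ).val - 1 ∈ weightSubgroup F r 1 :=
    hH _ (inv_mem (mul_mem hh hg))
  -- The commutator minus 1 is (xy - yx)(hg)⁻¹, and the unitriangular factor (hg)⁻¹ only changes
  -- entries of higher weight.
  have hcomm : ((g * h * (h * g)⁻¹ : (Matrix (Fin r) (Fin r) F)ˣ) : Matrix (Fin r) (Fin r) F) - 1 =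
      (x * y - y * x) * ((h * g)⁻¹ : (Matrix (Fin r) (Fin r) F)ˣ).val := by
    have h1 : x * y - y * x = (g * h : (Matrix (Fin r) (Fin r) F)ˣ).val -
        (h * g : (Matrix (Fin r) (Fin r) F)ˣ).val := by
      rw [hx, hy, Units.val_mul, Units.val_mul]
      noncomm_ring
    rw [h1, sub_mul, Units.mul_inv, Units.val_mul]
  have hdiff := sub_one_mul_mem_weightSubgroup (sub_mem hxy hyx) hu
  have hgab : x a b ≠ 0 := by rwa [hx, Matrix.sub_apply, Matrix.one_apply_ne hab'.ne, sub_zero]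
  have hhbc : y b c ≠ 0 := by rwa [hy, Matrix.sub_apply, Matrix.one_apply_ne hbc'.ne, sub_zero]
  have hxyac : (x * y) a c = x a b * y b c := by
    rw [Matrix.mul_apply]
    refine Finset.sum_eq_single b (fun d _ hd => ?_) (by simp)
    by_contra h0
    have h1 := hgw a d (left_ne_zero_of_mul h0)
    have h2 := hhw d c (right_ne_zero_of_mul h0)
    exact hd (Fin.ext (Nat.pow_right_injective le_rfl (by dsimp only; omega)))
  -- A nonzero term would force (a, d) to have the weight of (b, c), hence a = b.
  have hyxac : (y * x) a c = 0 := by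
    rw [Matrix.mul_apply]
    refine Finset.sum_eq_zero fun d _ => ?_
    by_contra h0
    have h1 := hhw a d (left_ne_zero_of_mul h0)
    have h2 := hgw d c (right_ne_zero_of_mul h0)
    have had : (a : ℕ) < d := (Nat.pow_lt_pow_iff_right (a := 2) (by norm_num)).1 (by omega)
    have := two_pow_sub_two_pow_inj had (Fin.lt_def.1 hbc') (by omega)
    have hab'' := Fin.lt_def.1 hab'
    omega
  refine ⟨hac, g * h * (h * g)⁻¹, mul_mem (mul_mem hg hh) (inv_mem (mul_mem hh hg)), ?_, ?_⟩
  · rw [hcomm]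
    have := add_mem (weightSubgroup_anti (Nat.le_succ _) hdiff) (sub_mem hxy hyx)
    rwa [sub_add_cancel] at this
  · have hz : ((x * y - y * x) * ((h * g)⁻¹ : (Matrix (Fin r) (Fin r) F)ˣ).val) a c -
        (x * y - y * x) a c = 0 := by
      rw [← Matrix.sub_apply]
      by_contra h0
      have := hdiff a c h0
      omega
    have hval := congrFun (congrFun hcomm a) c
    rw [Matrix.sub_apply, Matrix.one_apply_ne hac.ne, sub_zero, sub_eq_zero.1 hz,
      Matrix.sub_apply, hxyac, hyxac, sub_zero] at hval
    simp only
    rw [hval]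
    exact mul_ne_zero hgab hhbc

/-- A subgroup of a unitriangular group over a prime field is determined by its leading positions
among the groups containing it. -/
theorem le_of_leadingPositions_subset {p : ℕ} [Fact p.Prime]
    {H K : Subgroup (Matrix (Fin r) (Fin r) (ZMod p))ˣ} (hKH : K ≤ H)
    (hH : ∀ g ∈ H, (g : Matrix (Fin r) (Fin r) (ZMod p)) - 1 ∈ weightSubgroup (ZMod p) r 1)
    (h : leadingPositions H ⊆ leadingPositions K) : H ≤ K := by
  have key : ∀ d c : ℕ, c + d = 2 ^ r → 1 ≤ c → ∀ g ∈ H,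
      (g : Matrix (Fin r) (Fin r) (ZMod p)) - 1 ∈ weightSubgroup (ZMod p) r c → g ∈ K := by
    intro d
    induction d with
    | zero =>
      intro c hc _ g _ hg
      rw [add_zero] at hc
      rw [hc] at hg
      have := eq_zero_of_mem_weightSubgroup hg
      obtain rfl : g = 1 := Units.ext (sub_eq_zero.1 this)
      exact one_mem K
    | succ d ih =>
      intro c hc hc1 g hgH hg
      by_cases hgc : (g : Matrix (Fin r) (Fin r) (ZMod p)) - 1 ∈ weightSubgroup (ZMod p) r (c + 1)
      · exact ih (c + 1) (by omega) (by omega) g hgH hgc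
      rw [mem_weightSubgroup] at hgc
      push Not at hgc
      obtain ⟨a, b, hab0, hab⟩ := hgc
      have hab' := hg a b hab0
      have heq : 2 ^ (a : ℕ) + c = 2 ^ (b : ℕ) := by omega
      have hlt : a < b := Fin.lt_def.2
        ((Nat.pow_lt_pow_iff_right (a := 2) (by norm_num)).1 (by omega))
      have hw : 2 ^ (b : ℕ) - 2 ^ (a : ℕ) = c := by omega
      rw [Matrix.sub_apply, Matrix.one_apply_ne hlt.ne, sub_zero] at hab0
      obtain ⟨-, s, hs, hsw, hs0⟩ :=
        h (show (a, b) ∈ leadingPositions H from ⟨hlt, g, hgH, by simpa only [hw] using hg, hab0⟩)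
      simp only [hw] at hsw hs0
      -- Over a prime field every scalar is an integer multiple of 1, so some power of s cancels the
      -- entry of g at (a, b). No other position has weight c, so g s^n has weight at least c + 1.
      obtain ⟨n, hn⟩ := ZMod.natCast_zmod_surjective
        (-(g : Matrix (Fin r) (Fin r) (ZMod p)) a b / (s : Matrix (Fin r) (Fin r) (ZMod p)) a b)
      have hpow : ∀ m : ℕ, ((s ^ m : (Matrix (Fin r) (Fin r) (ZMod p))ˣ) :
          Matrix (Fin r) (Fin r) (ZMod p)) - 1 -
          (m : ZMod p) • ((s : Matrix (Fin r) (Fin r) (ZMod p)) - 1) ∈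
          weightSubgroup (ZMod p) r (c + 1) := by
        intro m
        induction m with
        | zero => simp
        | succ m ihm =>
          have h3 := sub_one_mul_mem_weightSubgroup hsw (hH _ (hKH (pow_mem hs m)))
          have := add_mem ihm h3
          convert this using 1
          rw [pow_succ', Units.val_mul, Nat.cast_succ, add_smul, one_smul]
          noncomm_ring
      have hgs : ((g * s ^ n : (Matrix (Fin r) (Fin r) (ZMod p))ˣ) :
          Matrix (Fin r) (Fin r) (ZMod p)) - 1 -
          ((g : Matrix (Fin r) (Fin r) (ZMod p)) - 1 +
            (n : ZMod p) • ((s : Matrix (Fin r) (Fin r) (ZMod p)) - 1)) ∈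
          weightSubgroup (ZMod p) r (c + 1) := by
        have h3 := sub_one_mul_mem_weightSubgroup hg (hH _ (hKH (pow_mem hs n)))
        convert add_mem (hpow n) h3 using 1
        rw [Units.val_mul]
        noncomm_ring
      have hmem : g * s ^ n ∈ K := by
        refine ih (c + 1) (by omega) (by omega) _ (mul_mem hgH (hKH (pow_mem hs n))) ?_
        have h5 : (g : Matrix (Fin r) (Fin r) (ZMod p)) - 1 +
            (n : ZMod p) • ((s : Matrix (Fin r) (Fin r) (ZMod p)) - 1) ∈
            weightSubgroup (ZMod p) r (c + 1) := by
          intro i j hij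
          have hle : 2 ^ (i : ℕ) + c ≤ 2 ^ (j : ℕ) := by
            rw [Matrix.add_apply, Matrix.smul_apply] at hij
            by_cases hgij : ((g : Matrix (Fin r) (Fin r) (ZMod p)) - 1) i j = 0
            · rw [hgij, zero_add] at hij
              exact hsw i j (right_ne_zero_of_mul hij)
            · exact hg i j hgij
          by_contra hlt'
          have hij_lt : (i : ℕ) < j :=
            (Nat.pow_lt_pow_iff_right (a := 2) (by norm_num)).1 (by omega)
          obtain ⟨hia, hjb⟩ := two_pow_sub_two_pow_inj hij_lt (Fin.lt_def.1 hlt) (by omega)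
          obtain rfl := Fin.ext hia
          obtain rfl := Fin.ext hjb
          apply hij
          rw [Matrix.add_apply, Matrix.smul_apply, Matrix.sub_apply, Matrix.sub_apply,
            Matrix.one_apply_ne hlt.ne, sub_zero, sub_zero, hn, smul_eq_mul,
            div_mul_cancel₀ _ hs0, add_neg_cancel]
        have := add_mem hgs h5
        rwa [sub_add_cancel] at this
      rw [← mul_inv_cancel_right g (s ^ n)]
      exact mul_mem hmem (inv_mem (pow_mem hs n))
  intro g hg
  exact key (2 ^ r - 1) 1 (Nat.add_sub_cancel' Nat.one_le_two_pow) le_rfl g hg (hH g hg)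

/-- Mantel's theorem for the indecomposable pairs of a transitive relation. -/
theorem card_le_of_indecomposable (S : Finset (Fin r × Fin r)) (Φ : Set (Fin r × Fin r))
    (hSΦ : ∀ a ∈ S, a ∈ Φ) (hlt : ∀ a ∈ Φ, a.1 < a.2)
    (hS : ∀ a ∈ S, ∀ d, (a.1, d) ∈ Φ → (d, a.2) ∈ Φ → False) : S.card ≤ r ^ 2 / 4 := by
  classical
  -- A triangle on a < b < c would decompose (a, c) through b.
  let G : SimpleGraph (Fin r) :=
    { Adj := fun a b => (a, b) ∈ S ∨ (b, a) ∈ S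
      symm := ⟨fun a b h => h.symm⟩
      loopless := ⟨fun a h => (hlt (a, a) (hSΦ _ (h.elim id id))).false⟩ }
  have hno : ∀ a b c : Fin r, a < b → b < c → G.Adj a b → G.Adj b c → G.Adj a c → False := by
    have hor : ∀ {a b : Fin r}, a < b → G.Adj a b → (a, b) ∈ S := fun {a b} hab h =>
      h.resolve_right fun h' => (hlt _ (hSΦ _ h')).asymm hab
    intro a b c hab hbc h1 h2 h3
    exact hS _ (hor (hab.trans hbc) h3) b (hSΦ _ (hor hab h1)) (hSΦ _ (hor hbc h2))
  have hfree : G.CliqueFree (2 + 1) := by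
    intro s hs
    obtain ⟨a, b, c, hab, hac, hbc, -⟩ := SimpleGraph.is3Clique_iff.1 hs
    rcases lt_trichotomy a b with h1 | h1 | h1
    · rcases lt_trichotomy b c with h2 | h2 | h2
      · exact hno a b c h1 h2 hab hbc hac
      · exact G.ne_of_adj hbc h2
      · rcases lt_trichotomy a c with h3 | h3 | h3
        · exact hno a c b h3 h2 hac hbc.symm hab
        · exact G.ne_of_adj hac h3
        · exact hno c a b h3 h1 hac.symm hab hbc.symm
    · exact G.ne_of_adj hab h1
    · rcases lt_trichotomy b c with h2 | h2 | h2
      · rcases lt_trichotomy a c with h3 | h3 | h3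
        · exact hno b a c h1 h3 hab.symm hac hbc
        · exact G.ne_of_adj hac h3
        · exact hno b c a h2 h3 hbc hac.symm hab.symm
      · exact G.ne_of_adj hbc h2
      · exact hno c b a h2 h1 hbc.symm hab.symm hac.symm
  have hT := hfree.card_edgeFinset_le
  have hcard : S.card ≤ G.edgeFinset.card := by
    refine Finset.card_le_card_of_injOn (fun a => s(a.1, a.2)) ?_ ?_
    · intro a ha
      rw [Finset.mem_coe, SimpleGraph.mem_edgeFinset, SimpleGraph.mem_edgeSet]
      exact Or.inl ha
    · intro a ha b hb hab
      have h1 := hlt _ (hSΦ _ (Finset.mem_coe.1 ha))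
      have h2 := hlt _ (hSΦ _ (Finset.mem_coe.1 hb))
      rcases Sym2.eq_iff.1 hab with ⟨h3, h4⟩ | ⟨h3, h4⟩
      · exact Prod.ext h3 h4
      · rw [h3, h4] at h1
        exact absurd h1 h2.asymm
  refine hcard.trans (hT.trans ?_)
  simp only [Fintype.card_fin]
  rcases Nat.mod_two_eq_zero_or_one r with h | h <;> rw [h] <;> norm_num
  exact Nat.div_le_div_right (Nat.sub_le _ _)

/-- Choose one element of H for each indecomposable leading position. By transitivity the subgroup
they generate has all leading positions of H, hence equals H. -/
theorem generatedBy_of_unitriangular {p : ℕ} [Fact p.Prime]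
    {H : Subgroup (Matrix (Fin r) (Fin r) (ZMod p))ˣ}
    (hH : ∀ g ∈ H, (g : Matrix (Fin r) (Fin r) (ZMod p)) - 1 ∈ weightSubgroup (ZMod p) r 1) :
    H.GeneratedBy (r ^ 2 / 4) := by
  classical
  let S : Finset (Fin r × Fin r) := Finset.univ.filter fun a => a ∈ leadingPositions H ∧
    ∀ d, (a.1, d) ∈ leadingPositions H → (d, a.2) ∈ leadingPositions H → False
  have hS : ∀ a, a ∈ S ↔ a ∈ leadingPositions H ∧
    ∀ d, (a.1, d) ∈ leadingPositions H → (d, a.2) ∈ leadingPositions H → False := by simp [S]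
  have hcard := card_le_of_indecomposable S (leadingPositions H) (fun a ha => ((hS a).1 ha).1)
    (fun a ha => ha.1) (fun a ha => ((hS a).1 ha).2)
  have hl : ∀ a : Fin r × Fin r, ∃ g : (Matrix (Fin r) (Fin r) (ZMod p))ˣ, a ∈ leadingPositions H →
      g ∈ H ∧ (g : Matrix (Fin r) (Fin r) (ZMod p)) - 1 ∈
        weightSubgroup (ZMod p) r (2 ^ (a.2 : ℕ) - 2 ^ (a.1 : ℕ)) ∧
        (g : Matrix (Fin r) (Fin r) (ZMod p)) a.1 a.2 ≠ 0 := fun a => by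
    by_cases ha : a ∈ leadingPositions H
    · obtain ⟨-, g, hg⟩ := ha
      exact ⟨g, fun _ => hg⟩
    · exact ⟨1, fun h => absurd h ha⟩
  choose l hl using hl
  have hle : Subgroup.closure ((S.image l : Finset _) : Set (Matrix (Fin r) (Fin r) (ZMod p))ˣ)
      ≤ H := by
    rw [Subgroup.closure_le]
    intro g hg
    obtain ⟨a, ha, rfl⟩ := Finset.mem_image.1 (Finset.mem_coe.1 hg)
    exact (hl a ((hS a).1 ha).1).1
  refine ⟨S.image l, Finset.card_image_le.trans hcard, le_antisymm hle
    (le_of_leadingPositions_subset hle hH ?_)⟩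
  have key : ∀ n : ℕ, ∀ a b : Fin r, (b : ℕ) - a ≤ n → (a, b) ∈ leadingPositions H →
      (a, b) ∈ leadingPositions (Subgroup.closure
        ((S.image l : Finset _) : Set (Matrix (Fin r) (Fin r) (ZMod p))ˣ)) := by
    intro n
    induction n with
    | zero =>
      intro a b hab h
      have := Fin.lt_def.1 h.1
      simp only at this
      omega
    | succ n ih =>
      intro a b hab h
      by_cases hd : ∃ d, (a, d) ∈ leadingPositions H ∧ (d, b) ∈ leadingPositions H
      · obtain ⟨d, h1, h2⟩ := hd
        have h3 := Fin.lt_def.1 h1.1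
        have h4 := Fin.lt_def.1 h2.1
        simp only at h3 h4
        exact leadingPositions_trans (fun g hg => hH g (hle hg))
          (ih a d (by omega) h1) (ih d b (by omega) h2)
      · have haS : (a, b) ∈ S := (hS _).2 ⟨h, fun d h1 h2 => hd ⟨d, h1, h2⟩⟩
        exact ⟨h.1, l (a, b),
          Subgroup.subset_closure (Finset.mem_coe.2 (Finset.mem_image_of_mem l haS)), (hl _ h).2⟩
  exact fun a ha => key _ a.1 a.2 le_rfl ha

end Unitriangular

/-! ### Triangularizing `p`-groups over `ZMod p`. -/

/-- A `p`-group acting on a vector space over `ZMod p` fixes a nonzero vector of the quotient by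
a proper invariant subspace. -/
theorem exists_notMem_forall_map_sub_mem {p : ℕ} [Fact p.Prime] {X V : Type*} [Group X]
    (hX : IsPGroup p X) [AddCommGroup V] [Module (ZMod p) V] [FiniteDimensional (ZMod p) V]
    (ρ : X →* (V →ₗ[ZMod p] V)) {W : Submodule (ZMod p) V} (hW : W ≠ ⊤)
    (hinv : ∀ x, ∀ w ∈ W, ρ x w ∈ W) : ∃ v ∉ W, ∀ x, ρ x v - v ∈ W := by
  have : Finite (V ⧸ W) := Module.finite_of_finite (ZMod p)
  let _ : MulAction X (V ⧸ W) :=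
    { smul := fun x => W.mapQ W (ρ x) (hinv x)
      one_smul := fun v => by
        obtain ⟨v, rfl⟩ := W.mkQ_surjective v
        change W.mapQ W (ρ 1) _ _ = _
        simp
      mul_smul := fun x y v => by
        obtain ⟨v, rfl⟩ := W.mkQ_surjective v
        change W.mapQ W (ρ (x * y)) _ _ = W.mapQ W (ρ x) _ (W.mapQ W (ρ y) _ _)
        simp }
  have : Nontrivial (V ⧸ W) := Submodule.Quotient.nontrivial_iff.2 hW
  have hdvd : p ∣ Nat.card (V ⧸ W) := by
    rw [Module.natCard_eq_pow_finrank (K := ZMod p), Nat.card_zmod]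
    exact dvd_pow_self p Module.finrank_pos.ne'
  obtain ⟨b, hb, hb0⟩ := hX.exists_fixed_point_of_prime_dvd_card_of_fixed_point (V ⧸ W) hdvd
    (a := 0) (fun x => map_zero (W.mapQ W (ρ x) (hinv x)))
  obtain ⟨v, rfl⟩ := W.mkQ_surjective b
  refine ⟨v, fun hv => hb0 ?_, fun x => ?_⟩
  · exact ((Submodule.Quotient.mk_eq_zero W).2 hv).symm
  · rw [← Submodule.Quotient.eq]
    exact hb x

/-- Adjoin repeatedly a vector that is fixed modulo the span of the earlier ones. -/
theorem exists_unitriangular_basis {p : ℕ} [Fact p.Prime] {X V : Type*} [Group X]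
    (hX : IsPGroup p X) [AddCommGroup V] [Module (ZMod p) V] [FiniteDimensional (ZMod p) V]
    (ρ : X →* (V →ₗ[ZMod p] V)) {r : ℕ} (hr : Module.finrank (ZMod p) V = r) :
    ∃ v : Module.Basis (Fin r) (ZMod p) V,
      ∀ x j, ρ x (v j) - v j ∈ Submodule.span (ZMod p) (v '' {i | i < j}) := by
  have key : ∀ m ≤ r, ∃ v : Fin m → V, LinearIndependent (ZMod p) v ∧
      ∀ x j, ρ x (v j) - v j ∈ Submodule.span (ZMod p) (v '' {i | i < j}) := by
    intro m
    induction m with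
    | zero => exact fun _ => ⟨Fin.elim0, linearIndependent_empty_type, fun _ j => j.elim0⟩
    | succ m ih =>
      intro hm
      obtain ⟨v, hv, hv'⟩ := ih (by omega)
      have htop : Submodule.span (ZMod p) (Set.range v) ≠ ⊤ := fun h => by
        have := finrank_span_eq_card hv
        rw [h, finrank_top, hr, Fintype.card_fin] at this
        omega
      have hinv : ∀ x, ∀ w ∈ Submodule.span (ZMod p) (Set.range v),
          ρ x w ∈ Submodule.span (ZMod p) (Set.range v) := by
        intro x
        change _ ≤ (Submodule.span (ZMod p) (Set.range v)).comap (ρ x)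
        rw [Submodule.span_le]
        rintro _ ⟨j, rfl⟩
        have := add_mem (Submodule.span_mono (Set.image_subset_range _ _) (hv' x j))
          (Submodule.subset_span (Set.mem_range_self j))
        rwa [sub_add_cancel] at this
      obtain ⟨w, hw, hw'⟩ := exists_notMem_forall_map_sub_mem hX ρ htop hinv
      refine ⟨Fin.snoc v w, hv.finSnoc hw, fun x j => ?_⟩
      induction j using Fin.lastCases with
      | last =>
        rw [Fin.snoc_last]
        refine Submodule.span_mono ?_ (hw' x)
        rintro _ ⟨i, rfl⟩
        exact ⟨i.castSucc, i.castSucc_lt_last, by rw [Fin.snoc_castSucc]⟩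
      | cast j =>
        rw [Fin.snoc_castSucc]
        refine Submodule.span_mono ?_ (hv' x j)
        rintro _ ⟨i, hi, rfl⟩
        exact ⟨i.castSucc, Fin.castSucc_lt_castSucc_iff.2 hi, by rw [Fin.snoc_castSucc]⟩
  obtain ⟨v, hv, hv'⟩ := key r le_rfl
  refine ⟨basisOfLinearIndependentOfCardEqFinrank' v hv (by simp [hr]), ?_⟩
  simpa using hv'

/-! ### Automorphisms of abelian `p`-groups through integer matrices. -/

/-- The pairs of an element `x` and an integer matrix describing the action of `x` on the
family `e`. -/
def matrixSubmonoid {X A : Type*} [Group X] [AddCommGroup A] (f : X →* AddMonoid.End A) {r : ℕ}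
    (e : Fin r → A) : Submonoid (X × Matrix (Fin r) (Fin r) ℤ) where
  carrier := {a | ∀ j, f a.1 (e j) = ∑ i, a.2 i j • e i}
  one_mem' := fun j => by simp [Matrix.one_apply]
  mul_mem' := by
    rintro ⟨x, M⟩ ⟨y, N⟩ hM hN j
    change f (x * y) (e j) = ∑ i, (M * N) i j • e i
    rw [map_mul]
    change f x (f y (e j)) = _
    have hM' : ∀ j, f x (e j) = ∑ i, M i j • e i := hM
    have hN' : f y (e j) = ∑ i, N i j • e i := hN j
    simp only [hN', map_sum, map_zsmul, hM', Finset.smul_sum, Matrix.mul_apply, Finset.sum_smul,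
      smul_smul]
    rw [Finset.sum_comm]
    simp only [mul_comm]

theorem mem_matrixSubmonoid_one_add {X A : Type*} [Group X] [AddCommGroup A]
    {f : X →* AddMonoid.End A} {r : ℕ} {e : Fin r → A} {x : X} {c : ℕ}
    {Y : Matrix (Fin r) (Fin r) ℤ} :
    (x, 1 + (c : Matrix (Fin r) (Fin r) ℤ) * Y) ∈ matrixSubmonoid f e ↔
      ∀ j, f x (e j) = e j + c • ∑ i, Y i j • e i := by
  refine forall_congr' fun j => ?_
  rw [← nsmul_eq_mul]
  simp only [Matrix.add_apply, Matrix.smul_apply, add_smul, Finset.sum_add_distrib, smul_assoc,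
    Finset.smul_sum, Matrix.one_apply, ite_smul, one_smul, zero_smul, Finset.sum_ite_eq',
    Finset.mem_univ, if_true]

/-- Nakayama's lemma for the nilpotent operator p: substitute the approximation into its own error
term n times. -/
theorem span_range_eq_top_of_nilpotent {A : Type*} [AddCommGroup A] {p n : ℕ}
    (hn : ∀ a : A, p ^ n • a = 0) {r : ℕ} {e : Fin r → A}
    (h : ∀ a : A, ∃ c ∈ Submodule.span ℤ (Set.range e), ∃ b, a - c = p • b) :
    Submodule.span ℤ (Set.range e) = ⊤ := by
  have key : ∀ m : ℕ, ∀ a : A, ∃ c ∈ Submodule.span ℤ (Set.range e), ∃ b, a - c = p ^ m • b := by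
    intro m
    induction m with
    | zero => exact fun a => ⟨0, zero_mem _, a, by simp⟩
    | succ m ih =>
      intro a
      obtain ⟨c, hc, b, hb⟩ := ih a
      obtain ⟨c', hc', b', hb'⟩ := h b
      refine ⟨c + p ^ m • c', add_mem hc (nsmul_mem hc' _), b', ?_⟩
      rw [pow_succ, mul_smul, ← hb', smul_sub, ← hb]
      abel
  refine eq_top_iff.2 fun a _ => ?_
  obtain ⟨c, hc, b, hb⟩ := key n a
  rw [hn, sub_eq_zero] at hb
  rwa [hb]

/-- Automorphisms of an abelian `p`-group `A` acting trivially on `A / pA`. -/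
theorem generatedBy_of_trivial_mod {p : ℕ} [Fact p.Prime] {X A : Type*} [Group X] [Finite X]
    [AddCommGroup A] (f : X →* AddMonoid.End A) (hf : Function.Injective f) {n : ℕ}
    (hn : ∀ a : A, p ^ n • a = 0) {r : ℕ} {e : Fin r → A}
    (he : Submodule.span ℤ (Set.range e) = ⊤) {K : Subgroup X}
    (hK : ∀ x ∈ K, ∀ a, ∃ b, f x a - a = p • b) :
    K.GeneratedBy ((if p = 2 then 2 else 1) * r ^ 2) := by
  let q : Matrix (Fin r) (Fin r) ℤ →+ Matrix (Fin r) (Fin r) (ZMod p) :=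
    (Int.castRingHom (ZMod p)).mapMatrix.toAddMonoidHom
  have hq : ∀ y, q y = 0 → ∃ z, y = (p : Matrix (Fin r) (Fin r) ℤ) * z := by
    intro y hy
    refine ⟨Matrix.of fun i j => y i j / p, ?_⟩
    ext i j
    have hij : ((y i j : ℤ) : ZMod p) = 0 := congrFun (congrFun hy i) j
    rw [← nsmul_eq_mul, Matrix.smul_apply, Matrix.of_apply, nsmul_eq_mul]
    exact (Int.mul_ediv_cancel' ((ZMod.intCast_zmod_eq_zero_iff_dvd _ p).1 hij)).symm
  have hrank : Module.finrank (ZMod p) (Matrix (Fin r) (Fin r) (ZMod p)) = r ^ 2 := by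
    simp [Module.finrank_matrix, sq]
  have hlevel : ∀ i x, x ∈ levelSubgroup (matrixSubmonoid f e) p i ↔
      ∃ Y : Matrix (Fin r) (Fin r) ℤ, ∀ j, f x (e j) = e j + p ^ i • ∑ l, Y l j • e l := by
    intro i x
    refine exists_congr fun Y => ?_
    rw [← mem_matrixSubmonoid_one_add, Nat.cast_pow]
  -- Level n is already trivial; n + 2 keeps the starting level, 1 or 2, below the last one even
  -- when n = 0.
  have hbot : levelSubgroup (matrixSubmonoid f e) p (n + 2) = ⊥ := by
    rw [Subgroup.eq_bot_iff_forall]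
    intro x hx
    obtain ⟨Y, hY⟩ := (hlevel _ _).1 hx
    apply hf
    rw [map_one]
    have : (f x).toIntLinearMap = (1 : AddMonoid.End A).toIntLinearMap := by
      refine LinearMap.ext_on_range he fun j => ?_
      change f x (e j) = e j
      rw [hY, add_comm n 2, pow_add, mul_smul, hn, smul_zero, add_zero]
    ext a
    exact LinearMap.congr_fun this a
  have hK1 : K ≤ levelSubgroup (matrixSubmonoid f e) p 1 := by
    intro x hx
    choose b hb using fun j => hK x hx (e j)
    have hspan : ∀ j, ∃ c : Fin r → ℤ, ∑ i, c i • e i = b j := fun j =>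
      (Submodule.mem_span_range_iff_exists_fun ℤ).1 (he ▸ Submodule.mem_top)
    choose c hc using hspan
    refine (hlevel _ _).2 ⟨Matrix.of fun i j => c j i, fun j => ?_⟩
    simp only [Matrix.of_apply, hc, pow_one, ← hb]
    abel
  split_ifs with hp
  · rw [two_mul, ← hrank]
    exact generatedBy_add_of_le_levelSubgroup hq le_rfl hK1
      (generatedBy_of_le_levelSubgroup hq hbot (by norm_num) (fun _ => le_rfl) (by omega)
        inf_le_right)
  · rw [one_mul, ← hrank]
    exact generatedBy_of_le_levelSubgroup hq hbot le_rfl (fun h => absurd h hp) (by omega) hK1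

theorem exists_representation_quotient {X A : Type*} [Group X] [AddCommGroup A] {p : ℕ}
    (f : X →* AddMonoid.End A) (pA : AddSubgroup A) [Module (ZMod p) (A ⧸ pA)]
    (hinv : ∀ x, pA ≤ pA.comap (f x)) : ∃ ρ : X →* (A ⧸ pA →ₗ[ZMod p] A ⧸ pA),
      ∀ x (a : A), ρ x (QuotientAddGroup.mk' pA a) = QuotientAddGroup.mk' pA (f x a) := by
  let g : X → (A ⧸ pA →ₗ[ZMod p] A ⧸ pA) := fun x =>
    AddMonoidHom.toZModLinearMap p (QuotientAddGroup.map pA pA (f x) (hinv x))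
  have hg : ∀ x (a : A), g x (a : A ⧸ pA) = ((f x a : A) : A ⧸ pA) := fun x a => rfl
  have hg1 : g 1 = 1 := by
    refine LinearMap.ext fun a => ?_
    obtain ⟨a, rfl⟩ := QuotientAddGroup.mk_surjective a
    rw [hg, map_one]
    rfl
  have hgm : ∀ x y, g (x * y) = g x * g y := fun x y => by
    refine LinearMap.ext fun a => ?_
    obtain ⟨a, rfl⟩ := QuotientAddGroup.mk_surjective a
    rw [hg, map_mul]
    rfl
  exact ⟨⟨⟨g, hg1⟩, hgm⟩, fun x a => rfl⟩

/-- The representation over `ZMod p` afforded by `A / pA`. -/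
theorem exists_zmod_representation.{u, w} {X : Type w} {A : Type u} [Group X] [AddCommGroup A]
    (p : ℕ) (f : X →* AddMonoid.End A) : ∃ (V : Type u) (_ : AddCommGroup V) (_ : Module (ZMod p) V)
      (π : A →+ V) (ρ : X →* (V →ₗ[ZMod p] V)), Function.Surjective π ∧
      (∀ a, π a = 0 → ∃ b, a = p • b) ∧ ∀ x a, ρ x (π a) = π (f x a) := by
  let pA : AddSubgroup A := (nsmulAddMonoidHom p : A →+ A).range
  let _ : Module (ZMod p) (A ⧸ pA) := QuotientAddGroup.zmodModule fun a => ⟨a, rfl⟩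
  have hinv : ∀ x, pA ≤ pA.comap (f x) := by
    rintro x _ ⟨a, rfl⟩
    exact ⟨f x a, (map_nsmul (f x) p a).symm⟩
  obtain ⟨ρ, hρ⟩ := exists_representation_quotient (p := p) f pA hinv
  refine ⟨A ⧸ pA, inferInstance, inferInstance, QuotientAddGroup.mk' pA, ρ,
    QuotientAddGroup.mk_surjective, fun a ha => ?_, hρ⟩
  obtain ⟨b, hb⟩ := (QuotientAddGroup.eq_zero_iff _).1 ha
  exact ⟨b, hb.symm⟩

theorem generatedBy_of_unitriangular_basis {p : ℕ} [Fact p.Prime] {X V : Type*} [Group X]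
    [AddCommGroup V] [Module (ZMod p) V] (ρ : X →* (V →ₗ[ZMod p] V)) {r : ℕ}
    (v : Module.Basis (Fin r) (ZMod p) V)
    (hv : ∀ x j, ρ x (v j) - v j ∈ Submodule.span (ZMod p) (v '' {i | i < j})) {m : ℕ}
    (hm : ∀ K : Subgroup X, (∀ x ∈ K, ρ x = 1) → K.GeneratedBy m) :
    (⊤ : Subgroup X).GeneratedBy (r ^ 2 / 4 + m) := by
  let F : X →* (Matrix (Fin r) (Fin r) (ZMod p))ˣ :=
    ((LinearMap.toMatrixAlgEquiv v : _ →* Matrix (Fin r) (Fin r) (ZMod p)).comp ρ).toHomUnits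
  have hF : ∀ x, (F x : Matrix (Fin r) (Fin r) (ZMod p)) = LinearMap.toMatrixAlgEquiv v (ρ x) :=
    fun x => rfl
  refine Subgroup.GeneratedBy.of_range_of_ker (F.comp (⊤ : Subgroup X).subtype) ?_ (hm _ ?_)
  · apply generatedBy_of_unitriangular
    rintro _ ⟨x, rfl⟩ i j hij
    have hx : (((F.comp (⊤ : Subgroup X).subtype) x : (Matrix (Fin r) (Fin r) (ZMod p))ˣ) :
        Matrix (Fin r) (Fin r) (ZMod p)) = LinearMap.toMatrixAlgEquiv v (ρ x) := hF _
    rw [hx, ← map_one (LinearMap.toMatrixAlgEquiv v), ← map_sub,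
      LinearMap.toMatrixAlgEquiv_apply, LinearMap.sub_apply, Module.End.one_apply] at hij
    have hlt : i < j := v.mem_span_image.1 (hv x j) (Finsupp.mem_support_iff.2 hij)
    exact Nat.pow_lt_pow_right (by norm_num) hlt
  · rintro _ ⟨x, hx, rfl⟩
    apply (LinearMap.toMatrixAlgEquiv v).injective
    rw [← hF, map_one]
    exact congrArg Units.val (MonoidHom.mem_ker.1 hx)

/-- Generator bound for a `p`-group of automorphisms of an abelian `p`-group. -/
theorem generatedBy_of_injective_end {p : ℕ} [Fact p.Prime] {X A : Type*} [Group X] [Finite X]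
    [AddCommGroup A] [Finite A] (f : X →* AddMonoid.End A) (hf : Function.Injective f) {n : ℕ}
    (hn : ∀ a : A, p ^ n • a = 0) {T : Finset A} (hT : AddSubgroup.closure (T : Set A) = ⊤)
    (hX : IsPGroup p X) :
    (⊤ : Subgroup X).GeneratedBy
      (T.card ^ 2 / 4 + (if p = 2 then 2 else 1) * T.card ^ 2) := by
  obtain ⟨V, _, _, π, ρ, hπ, hker, hρ⟩ := exists_zmod_representation p f
  have : Finite V := Finite.of_surjective π hπ
  have : FiniteDimensional (ZMod p) V := Module.Finite.of_finite
  obtain ⟨r, hr⟩ : ∃ r, Module.finrank (ZMod p) V = r := ⟨_, rfl⟩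
  obtain ⟨v, hv⟩ := exists_unitriangular_basis hX ρ hr
  have hrT : r ≤ T.card := by
    classical
    have hspan : Submodule.span (ZMod p) ((T.image π : Finset V) : Set V) = ⊤ := by
      have : AddSubgroup.closure (T : Set A) ≤
          (Submodule.span (ZMod p) ((T.image π : Finset V) : Set V)).toAddSubgroup.comap π := by
        rw [AddSubgroup.closure_le]
        exact fun a ha => Submodule.subset_span (Finset.mem_coe.2 (Finset.mem_image_of_mem _ ha))
      rw [hT] at this
      refine eq_top_iff.2 fun a _ => ?_
      obtain ⟨a, rfl⟩ := hπ a
      exact this (AddSubgroup.mem_top a)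
    have := finrank_span_finset_le_card (R := ZMod p) (T.image π)
    rw [Set.finrank, hspan, finrank_top, hr] at this
    exact this.trans Finset.card_image_le
  choose e he using fun j => hπ (v j)
  -- Lifts of the unitriangular basis generate A modulo pA, hence generate A.
  have hspan : Submodule.span ℤ (Set.range e) = ⊤ := by
    refine span_range_eq_top_of_nilpotent hn fun a => ?_
    choose c hc using fun j => ZMod.natCast_zmod_surjective (v.repr (π a) j)
    refine ⟨∑ j, c j • e j, sum_mem fun j _ =>
      nsmul_mem (Submodule.subset_span (Set.mem_range_self j)) _, hker _ ?_⟩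
    rw [map_sub, sub_eq_zero, map_sum]
    refine (v.sum_repr (π a)).symm.trans (Finset.sum_congr rfl fun j _ => ?_)
    rw [map_nsmul, ← hc, Nat.cast_smul_eq_nsmul, he]
  have hsq : r ^ 2 ≤ T.card ^ 2 := Nat.pow_le_pow_left hrT 2
  refine (generatedBy_of_unitriangular_basis ρ v hv fun K hK =>
    generatedBy_of_trivial_mod f hf hn hspan fun x hx a => hker _ ?_).mono
    (add_le_add (Nat.div_le_div_right hsq) (Nat.mul_le_mul_left _ hsq))
  rw [map_sub, ← hρ, hK x hx, sub_eq_zero]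
  rfl

/-! ### Self-centralizing invariant abelian subgroups. -/

theorem generatedBy_of_pruferRank {G : Type*} [Group G] [Finite G] {k : ℕ}
    (hk : pruferRank G = (k : ℕ∞)) (H : Subgroup G) : H.GeneratedBy k := by
  obtain ⟨S, hS, hc⟩ := Group.rank_spec H
  have hle : (Group.rank H : ℕ∞) ≤ k := by
    rw [← hk, pruferRank]
    exact le_iSup₂ (f := fun (H : Subgroup G) (_ : Group.FG H) => (Group.rank H : ℕ∞)) H
      inferInstance
  have h : (⊤ : Subgroup H).GeneratedBy k := ⟨S, hS.le.trans (Nat.cast_le.1 hle), hc⟩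
  have h' := h.map H.subtype
  rwa [← MonoidHom.range_eq_map, H.range_subtype] at h'

/-- The restriction of automorphisms to an invariant subgroup. -/
noncomputable def restrictAut {G : Type*} [Group G] [Finite G] (Q : Subgroup (MulAut G))
    (C : Subgroup G) (hC : ∀ φ ∈ Q, ∀ c ∈ C, φ c ∈ C) : Q →* MulAut C where
  toFun φ := MulEquiv.ofBijective
    ((φ : MulAut G).toMonoidHom.subgroupComap C |>.comp (Subgroup.inclusion (hC φ φ.2)))
    (Finite.injective_iff_bijective.1 fun a b h =>
      Subtype.ext ((φ : MulAut G).injective (congrArg Subtype.val h)))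
  map_one' := by ext; rfl
  map_mul' φ ψ := by ext; rfl

/-- A `p`-group acting on a `p`-group `G` fixes a nontrivial coset of a proper invariant
subgroup. -/
theorem exists_notMem_forall_inv_mul_mem {p : ℕ} [Fact p.Prime] {X G : Type*} [Group X]
    (hX : IsPGroup p X) [Group G] [Finite G] (hG : IsPGroup p G) (f : X →* MulAut G)
    {A : Subgroup G} (hA : A ≠ ⊤) (hinv : ∀ x, ∀ a ∈ A, f x a ∈ A) :
    ∃ g ∉ A, ∀ x, g⁻¹ * f x g ∈ A := by
  have hmap : ∀ x (g h : G), QuotientGroup.leftRel A g h →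
      QuotientGroup.leftRel A (f x g) (f x h) := fun x g h hgh => by
    rw [QuotientGroup.leftRel_apply] at hgh ⊢
    rw [← map_inv, ← map_mul]
    exact hinv x _ hgh
  let _ : MulAction X (G ⧸ A) :=
    { smul := fun x => Quotient.map' (f x) (hmap x)
      one_smul := fun b => by
        obtain ⟨g, rfl⟩ := QuotientGroup.mk_surjective b
        change ((f 1 g : G) : G ⧸ A) = g
        rw [map_one, MulAut.one_apply]
      mul_smul := fun x y b => by
        obtain ⟨g, rfl⟩ := QuotientGroup.mk_surjective b
        change ((f (x * y) g : G) : G ⧸ A) = ((f x (f y g) : G) : G ⧸ A)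
        rw [map_mul, MulAut.mul_apply] }
  have hdvd : p ∣ Nat.card (G ⧸ A) := by
    obtain ⟨n, hn⟩ := hG.index A
    rw [← Subgroup.index_eq_card, hn]
    refine dvd_pow_self p fun h0 => hA ?_
    rwa [h0, pow_zero, Subgroup.index_eq_one] at hn
  obtain ⟨b, hb, hb0⟩ := hX.exists_fixed_point_of_prime_dvd_card_of_fixed_point (G ⧸ A) hdvd
    (a := ((1 : G) : G ⧸ A)) (fun x => congrArg (QuotientGroup.mk (s := A)) (map_one (f x)))
  obtain ⟨g, rfl⟩ := QuotientGroup.mk_surjective b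
  refine ⟨g, fun hg => hb0 ?_, fun x => ?_⟩
  · rw [QuotientGroup.eq]
    simpa using hg
  · exact QuotientGroup.eq.1 (hb x).symm

/-- An abelian subgroup maximal among those invariant under a `p`-group of automorphisms
containing the inner ones is its own centralizer. -/
theorem exists_invariant_centralizer_eq {p : ℕ} [Fact p.Prime] {G : Type*} [Group G] [Finite G]
    (hG : IsPGroup p G) {Q : Subgroup (MulAut G)} (hQ : IsPGroup p Q)
    (hinn : (MulAut.conj : G →* MulAut G).range ≤ Q) :
    ∃ A : Subgroup G, A.Normal ∧ (∀ φ ∈ Q, ∀ a ∈ A, φ a ∈ A) ∧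
      Subgroup.centralizer (A : Set G) = A := by
  let good : Set (Subgroup G) :=
    {A | (∀ φ ∈ Q, ∀ a ∈ A, φ a ∈ A) ∧ ∀ a ∈ A, ∀ b ∈ A, a * b = b * a}
  have hgood : (⊥ : Subgroup G) ∈ good := by
    refine ⟨?_, ?_⟩ <;> simp +contextual [Subgroup.mem_bot]
  obtain ⟨A, hA⟩ := (Set.toFinite good).exists_maximal ⟨_, hgood⟩
  obtain ⟨⟨hinv, hcomm⟩, hmax⟩ := hA
  have hnormal : A.Normal := ⟨fun a ha g => hinv _ (hinn ⟨g, rfl⟩) a ha⟩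
  have hAC : A ≤ Subgroup.centralizer (A : Set G) := fun a ha =>
    Subgroup.mem_centralizer_iff.2 fun b hb => hcomm b hb a ha
  refine ⟨A, hnormal, hinv, le_antisymm ?_ hAC⟩
  by_contra hlt
  set C := Subgroup.centralizer (A : Set G) with hC
  have hCinv : ∀ φ ∈ Q, ∀ c ∈ C, φ c ∈ C := by
    intro φ hφ c hc
    rw [hC, Subgroup.mem_centralizer_iff] at hc ⊢
    intro a ha
    have h1 := hc _ (hinv _ (inv_mem hφ) a ha)
    have h2 := congrArg φ h1
    simpa using h2
  -- Adjoining x to A keeps it abelian, as x centralizes A, and invariant, as φ(x) ∈ xA. This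
  -- contradicts maximality.
  obtain ⟨x, hxA, hx⟩ := exists_notMem_forall_inv_mul_mem hQ (hG.to_subgroup C)
    (restrictAut Q C hCinv) (A := A.subgroupOf C) (fun h => hlt (Subgroup.subgroupOf_eq_top.1 h))
    (fun φ a ha => hinv _ φ.2 _ ha)
  have hxA' : (x : G) ∉ A := hxA
  have hx' : ∀ φ ∈ Q, (x : G)⁻¹ * φ x ∈ A := fun φ hφ => hx ⟨φ, hφ⟩
  let B : Subgroup G := Subgroup.closure (insert (x : G) (A : Set G))
  have hAB : A ≤ B := fun a ha => Subgroup.subset_closure (Set.mem_insert_of_mem _ ha)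
  have hxB : (x : G) ∈ B := Subgroup.subset_closure (Set.mem_insert _ _)
  have hBgood : B ∈ good := by
    refine ⟨fun φ hφ => ?_, fun a ha b hb => ?_⟩
    · change B ≤ B.comap (φ : MulAut G).toMonoidHom
      rw [Subgroup.closure_le]
      rintro a (rfl | ha)
      · have := mul_mem hxB (hAB (hx' φ hφ))
        rwa [mul_inv_cancel_left] at this
      · exact hAB (hinv φ hφ a ha)
    · have hxc := Subgroup.mem_centralizer_iff.1 x.2
      refine Subgroup.closure_induction₂ (p := fun a b _ _ => a * b = b * a) ?_ ?_ ?_ ?_ ?_ ?_ ?_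
        ha hb
      · rintro a b (rfl | ha) (rfl | hb)
        · rfl
        · exact (hxc b hb).symm
        · exact hxc a ha
        · exact hcomm a ha b hb
      · exact fun a _ => (Commute.one_left a).eq
      · exact fun a _ => (Commute.one_right a).eq
      · exact fun a b c _ _ _ h1 h2 => (Commute.mul_left (h1 : Commute a c) h2).eq
      · exact fun a b c _ _ _ h1 h2 => (Commute.mul_right (h1 : Commute c a) h2).eq
      · exact fun a b _ _ h => (Commute.inv_left (h : Commute a b)).eq
      · exact fun a b _ _ h => (Commute.inv_right (h : Commute a b)).eq
  exact hxA' (hmax hBgood hAB hxB)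

/-- Automorphisms fixing pointwise a self-centralizing normal subgroup act trivially on its
cosets. -/
theorem inv_mul_mem_of_fixes {G : Type*} [Group G] {A : Subgroup G} [A.Normal]
    (hA : Subgroup.centralizer (A : Set G) = A) {φ : MulAut G} (hφ : ∀ a ∈ A, φ a = a) (g : G) :
    g⁻¹ * φ g ∈ A := by
  rw [← hA, Subgroup.mem_centralizer_iff]
  intro a ha
  -- By normality φ fixes gag⁻¹, so g and φ(g) conjugate a to the same element.
  have h1 := hφ (g * a * g⁻¹) (Subgroup.Normal.conj_mem inferInstance a ha g)
  rw [map_mul, map_mul, map_inv, hφ a ha] at h1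
  have h2 : φ g * a = g * a * g⁻¹ * φ g := by rw [← h1]; group
  rw [mul_assoc, h2]
  group

/-! ### Assembling the bounds. -/

theorem generatedBy_of_abelian {p : ℕ} [Fact p.Prime] {X A : Type*} [Group X] [Finite X]
    [CommGroup A] [Finite A] (f : X →* MulAut A) (hf : Function.Injective f) (hA : IsPGroup p A)
    {k : ℕ} (hT : (⊤ : Subgroup A).GeneratedBy k) (hX : IsPGroup p X) :
    (⊤ : Subgroup X).GeneratedBy (k ^ 2 / 4 + (if p = 2 then 2 else 1) * k ^ 2) := by
  obtain ⟨T, hTk, hT⟩ := hT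
  obtain ⟨n, hn⟩ := IsPGroup.iff_card.1 hA
  let F : X →* AddMonoid.End (Additive A) :=
    { toFun := fun x => (f x).toMonoidHom.toAdditive
      map_one' := by rw [map_one]; rfl
      map_mul' := fun x y => by rw [map_mul]; rfl }
  have hF : Function.Injective F := fun x y h => hf (MulEquiv.ext fun a => DFunLike.congr_fun h a)
  have hsq : T.card ^ 2 ≤ k ^ 2 := Nat.pow_le_pow_left hTk 2
  have hcl : AddSubgroup.closure ((T.map Additive.ofMul.toEmbedding : Finset (Additive A)) :
      Set (Additive A)) = ⊤ := by
    have h : Subgroup.toAddSubgroup (Subgroup.closure (T : Set A)) = ⊤ := by rw [hT]; rfl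
    rw [Subgroup.toAddSubgroup_closure] at h
    rw [← h, Finset.coe_map]
    congr 1
    ext a
    simp
  have := generatedBy_of_injective_end F hF (n := n) (fun a => ?_) hcl hX
  · rw [Finset.card_map] at this
    exact this.mono (add_le_add (Nat.div_le_div_right hsq) (Nat.mul_le_mul_left _ hsq))
  · rw [← hn]
    exact card_nsmul_eq_zero' (G := Additive A)

theorem generatedBy_of_isPGroup_mulAut {p : ℕ} [Fact p.Prime] {G : Type*} [Group G] [Finite G]
    (hG : IsPGroup p G) {k : ℕ} (hk : ∀ H : Subgroup G, H.GeneratedBy k)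
    {P : Subgroup (MulAut G)} (hP : IsPGroup p P) :
    P.GeneratedBy (k ^ 2 / 4 + (if p = 2 then 2 else 1) * k ^ 2 + k ^ 2) := by
  have hinn : ((MulAut.conj : G →* MulAut G).range).Normal := by
    refine ⟨?_⟩
    rintro _ ⟨g, rfl⟩ φ
    exact ⟨φ g, by ext; simp⟩
  -- Inner automorphisms are adjoined so that invariant subgroups are normal in G.
  have hQ : IsPGroup p ↥((MulAut.conj : G →* MulAut G).range ⊔ P) :=
    IsPGroup.to_sup_of_normal_left (hG.of_surjective _ (MonoidHom.rangeRestrict_surjective _)) hP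
  obtain ⟨A, hnormal, hinv, hcent⟩ := exists_invariant_centralizer_eq hG hQ le_sup_left
  have hinvP : ∀ φ ∈ P, ∀ a ∈ A, φ a ∈ A := fun φ hφ => hinv φ (Subgroup.mem_sup_right hφ)
  have hcomm : ∀ a b : A, a * b = b * a := fun a b => by
    have hb : (b : G) ∈ Subgroup.centralizer (A : Set G) := hcent.symm ▸ b.2
    exact Subtype.ext (Subgroup.mem_centralizer_iff.1 hb a a.2)
  let _ : CommGroup A := { (inferInstance : Group A) with mul_comm := hcomm }
  let f := restrictAut P A hinvP
  refine Subgroup.GeneratedBy.of_range_of_ker f ?_ ?_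
  · have htop : (⊤ : Subgroup A).GeneratedBy k := by
      have hinj : Function.Injective (A.subtype.comp (⊤ : Subgroup A).subtype) :=
        A.subtype_injective.comp (⊤ : Subgroup A).subtype_injective
      refine Subgroup.GeneratedBy.of_range_of_ker (n := 0)
        (A.subtype.comp (⊤ : Subgroup A).subtype) (hk _) ⟨∅, le_rfl, ?_⟩
      rw [(MonoidHom.ker_eq_bot_iff _).2 hinj]
      simp
    have := (generatedBy_of_abelian f.range.subtype Subtype.coe_injective (hG.to_subgroup A) htop
      (hP.of_surjective _ f.rangeRestrict_surjective)).map f.range.subtype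
    rwa [← MonoidHom.range_eq_map, Subgroup.range_subtype] at this
  · obtain ⟨T, hT, hc⟩ := hk ⊤
    have hle : ∀ φ ∈ f.ker.map P.subtype, ∀ a ∈ A, φ a = a := by
      rintro _ ⟨φ, hφ, rfl⟩ a ha
      have h := DFunLike.congr_fun (MonoidHom.mem_ker.1 hφ) (⟨a, ha⟩ : A)
      exact congrArg Subtype.val h
    refine (generatedBy_of_fixes A k (fun B _ => hk B) T _ hle
      (fun φ hφ => inv_mul_mem_of_fixes hcent (hle φ hφ)) fun φ _ h => ?_).mono ?_
    · have heq : (φ : MulAut G).toMonoidHom = MonoidHom.id G := MonoidHom.eq_of_eqOn_dense hc h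
      exact MulEquiv.ext fun g => DFunLike.congr_fun heq g
    · rw [sq]
      exact Nat.mul_le_mul_right k hT

/-- If `G` is a finite `p`-group of rank `k`, every `p`-subgroup of `Aut(G)` can be generated by
at most `9k²/4` elements if `p > 2`, and by at most `(7k² - k)/2` elements if `p = 2`. -/
theorem corollaryD (p : ℕ) (hp : p.Prime) (G : Type*) [Group G] [Finite G] (hG : IsPGroup p G)
    (k : ℕ) (hk : pruferRank G = (k : ℕ∞)) (P : Subgroup (MulAut G)) (hP : IsPGroup p P) :
    (2 < p → ∃ S : Finset (MulAut G), Subgroup.closure (S : Set (MulAut G)) = P ∧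
      (S.card : ℝ) ≤ 9 * (k : ℝ) ^ 2 / 4) ∧
    (p = 2 → ∃ S : Finset (MulAut G), Subgroup.closure (S : Set (MulAut G)) = P ∧
      (S.card : ℝ) ≤ (7 * (k : ℝ) ^ 2 - (k : ℝ)) / 2) := by
  have : Fact p.Prime := ⟨hp⟩
  obtain ⟨S, hS, hc⟩ := generatedBy_of_isPGroup_mulAut hG (generatedBy_of_pruferRank hk) hP
  refine ⟨fun h2 => ⟨S, hc, ?_⟩, fun h2 => ⟨S, hc, ?_⟩⟩
  · rw [if_neg (by omega), one_mul] at hS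
    have h4 : 4 * S.card ≤ 9 * k ^ 2 := by omega
    rw [le_div_iff₀ (by norm_num), mul_comm]
    exact_mod_cast h4
  · rw [if_pos h2] at hS
    have h4 : 2 * S.card + k ≤ 7 * k ^ 2 := by
      -- For k ≥ 2 this is 13k²/4 ≤ (7k² - k)/2. At k = 1 the rounding of k²/4 down to 0 is
      -- essential and the bound 3 is met exactly.
      obtain rfl | rfl | hk2 : k = 0 ∨ k = 1 ∨ 2 ≤ k := by omega
      · omega
      · omega
      · have : 2 * k ≤ k ^ 2 := by rw [sq]; exact Nat.mul_le_mul_right k hk2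
        omega
    rw [le_div_iff₀ (by norm_num), le_sub_iff_add_le, mul_comm]
    exact_mod_cast h4
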